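/- Let $\mathbb{K}$ be $\mathbb{R}$ or $\mathbb{C}$, and let $\mathbf{Ban}_c$ be the category of Banach spaces over $\mathbb{K}$ and linear contractions (bounded linear maps of norm $\le 1$). Let $\Omega$ be a Boolean algebra, viewed as a category through its order, let $X=\mathrm{Stone}(\Omega)$ be its Stone space, i.e. the set of Boolean algebra morphisms $x\colon\Omega\to\{0,1\}$ with the topology having the sets $\eta(E)=\{x\in X: x(E)=1\}$, $E\in\Omega$, as a base, so that $\eta$ is the Stone isomorphism from $\Omega$ to the Boolean algebra of clopen subsets of $X$. A presheaf of Banach spaces on $X$ (resp. on $\Omega$) is a functor $\mathrm{Open}(X)^{op}\to\mathbf{Ban}_c$ (resp. $\Omega^{op}\to\mathbf{Ban}_c$), with restriction maps denoted $p_{U,V}$. For a presheaf $\xi$ on $X$ let $\xi_x=\operatorname{colim}_{V\ni x}\xi(V)$ be its stalk at $x$ (colimit in $\mathbf{Ban}_c$ over the open neighbourhoods of $x$), let $\widehat{\xi}(U)=\prod_{x\in U}\xi_x$ be the Banach space of bounded families with the supremum norm, and for $s\in\xi(U)$ let $\widehat{s}=(s_x)_{x\in U}\in\widehat{\xi}(U)$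 be the family of germs of $s$. The presheaf $\xi$ is a Banach sheaf if for every open $U\subseteq X$: 1. (uniqueness of patching) for every open cover $(U_i)$ of $U$ and every $s\in\xi(U)$, $\|s\|=\sup_i\|p_{U,U_i}(s)\|$ (the supremum in $[0,\infty)$, so that it is $0$ for the empty cover of $U=\emptyset$); 2. (approximation condition) if $t\in\widehat{\xi}(U)$ is such that for every $\epsilon>0$ and every $x\in U$ there are an open neighbourhood $V\subseteq U$ of $x$ and an $s\in\xi(V)$ with $\|t|_V-\widehat{s}\|<\epsilon$, then $t=\widehat{\sigma}$ for some $\sigma\in\xi(U)$. The finite Grothendieck topology on $\Omega$ is the one in which a sieve on $E$ is covering iff it contains a finite family with supremum $E$; let $\mathrm{Shv}(\Omega)$ be the category of $\mathbf{Ban}_c$-valued sheaves on $\Omega$ for this topology, and $\mathrm{Shv}(X)$ the category of Banach sheaves on $X$. Theorem. For a presheaf $\xi$ of Banach spaces on $X$, $\eta^{*}(\xi)\colon E\mapsto\xi(\eta(E))$ is a presheaf on $\Omega$; if $\xi$ is a Banach sheaf then $\eta^{*}(\xi)$ is a sheaf for the finite topology; and the functor $\xi\mapsto\eta^{*}(\xi)$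 is an equivalence $\mathrm{Shv}(X)\simeq\mathrm{Shv}(\Omega)$, in the sense of categories enriched in Banach spaces. That is, with contractive natural transformations as morphisms $\eta^{*}\colon\mathrm{Shv}(X)\to\mathrm{Shv}(\Omega)$ is an equivalence of categories, and for all Banach sheaves $\xi,\zeta$ on $X$ the map $\tau\mapsto\eta^{*}(\tau)=(\tau_{\eta(E)})_{E\in\Omega}$ is an isometric linear bijection from the Banach space of uniformly bounded natural transformations $\xi\to\zeta$ (the components being bounded linear maps, with norm $\|\tau\|=\sup_U\|\tau_U\|$) onto the corresponding space for $\eta^{*}(\xi)$, $\eta^{*}(\zeta)$. -/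

import Mathlib

open CategoryTheory Opposite TopologicalSpace
open scoped ENNReal

universe u

noncomputable section

namespace BanachSheaf

/-! ### The category of Banach spaces and linear contractions -/

/-- A Banach space over `𝕜`, bundled. -/
structure Banc (𝕜 : Type*) [RCLike 𝕜] where
  carrier : Type u
  [normedAddCommGroup : NormedAddCommGroup carrier]
  [normedSpace : NormedSpace 𝕜 carrier]
  [completeSpace : CompleteSpace carrier]

attribute [instance] Banc.normedAddCommGroup Banc.normedSpace Banc.completeSpace

instance (𝕜 : Type*) [RCLike 𝕜] : CoeSort (Banc 𝕜) (Type _) := ⟨Banc.carrier⟩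

/-- Linear contractions between Banach spaces. -/
@[ext]
structure Banc.Hom {𝕜 : Type*} [RCLike 𝕜] (A B : Banc 𝕜) where
  toCLM : A →L[𝕜] B
  norm_le_one : ‖toCLM‖ ≤ 1

instance (𝕜 : Type*) [RCLike 𝕜] : Category (Banc 𝕜) where
  Hom A B := Banc.Hom A B
  id A := ⟨ContinuousLinearMap.id 𝕜 A, ContinuousLinearMap.norm_id_le⟩
  comp f g := ⟨g.toCLM.comp f.toCLM,
    (ContinuousLinearMap.opNorm_comp_le _ _).trans
      (mul_le_one₀ g.norm_le_one (norm_nonneg _) f.norm_le_one)⟩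

/-- The continuous linear map underlying a morphism of `Banc 𝕜`. -/
def Banc.clm {𝕜 : Type*} [RCLike 𝕜] {A B : Banc 𝕜} (f : A ⟶ B) : A →L[𝕜] B :=
  Banc.Hom.toCLM f

lemma Banc.norm_clm_apply_le {𝕜 : Type*} [RCLike 𝕜] {A B : Banc 𝕜} (f : A ⟶ B) (a : A) :
    ‖Banc.clm f a‖ ≤ ‖a‖ := by
  simpa using (Banc.clm f).le_of_opNorm_le (Banc.Hom.norm_le_one f) a

/-! ### The Banach space of bounded natural transformations -/

section BddNat

variable {𝕜 : Type*} [RCLike 𝕜] {C D : Type*} [Category C] [Category D]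

/-- The space of uniformly bounded natural transformations `F → G` (the components are arbitrary
bounded linear maps), with the norm `‖τ‖ = sup_c ‖τ_c‖`. -/
def BddNat (F G : C ⥤ Banc 𝕜) : Submodule 𝕜 (lp (fun c : C => F.obj c →L[𝕜] G.obj c) ∞) where
  carrier := {τ | ∀ ⦃c d : C⦄ (f : c ⟶ d) (a : F.obj c),
    Banc.clm (G.map f) (τ c a) = τ d (Banc.clm (F.map f) a)}
  zero_mem' := by intro c d f a; simp
  add_mem' := by intro σ τ hσ hτ c d f a; simp [hσ f a, hτ f a]
  smul_mem' := by intro k τ hτ c d f a; simp [hτ f a]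

/-- Precomposition of a bounded natural transformation with a functor. -/
def BddNat.whisker (H : D ⥤ C) (F G : C ⥤ Banc 𝕜) :
    BddNat F G →ₗ[𝕜] BddNat (H ⋙ F) (H ⋙ G) where
  toFun τ := ⟨⟨fun d => τ.1 (H.obj d), memℓp_infty ⟨‖τ.1‖, by
      rintro _ ⟨d, rfl⟩
      exact lp.norm_apply_le_norm ENNReal.top_ne_zero τ.1 (H.obj d)⟩⟩,
    fun _ _ f a => τ.2 (H.map f) a⟩
  map_add' _ _ := rfl
  map_smul' _ _ := rfl

end BddNat

/-! ### Presheaves of Banach spaces on a topological space, stalks -/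

section Top

variable {𝕜 : Type*} [RCLike 𝕜] {X : Type u} [TopologicalSpace X]

/-- The restriction map `p_{U,V} : ξ(U) → ξ(V)` for `V ⊆ U`. -/
def res (ξ : (Opens X)ᵒᵖ ⥤ Banc.{u} 𝕜) {U V : Opens X} (h : V ≤ U) :
    ξ.obj (op U) →L[𝕜] ξ.obj (op V) :=
  Banc.clm (ξ.map (homOfLE h).op)

lemma norm_res_le (ξ : (Opens X)ᵒᵖ ⥤ Banc.{u} 𝕜) {U V : Opens X} (h : V ≤ U)
    (s : ξ.obj (op U)) : ‖res ξ h s‖ ≤ ‖s‖ :=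
  Banc.norm_clm_apply_le _ s

lemma res_self (ξ : (Opens X)ᵒᵖ ⥤ Banc.{u} 𝕜) {U : Opens X} (s : ξ.obj (op U)) :
    res ξ le_rfl s = s := by
  have h : (homOfLE (le_refl U)).op = 𝟙 (op U) := rfl
  rw [res, h, ξ.map_id]
  rfl

lemma res_res (ξ : (Opens X)ᵒᵖ ⥤ Banc.{u} 𝕜) {U V W : Opens X} (h : V ≤ U) (h' : W ≤ V)
    (s : ξ.obj (op U)) : res ξ h' (res ξ h s) = res ξ (h'.trans h) s := by
  have e : (homOfLE (h'.trans h)).op = (homOfLE h).op ≫ (homOfLE h').op := rfl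
  rw [res, res, res, e, ξ.map_comp]
  rfl

/-- The open neighbourhoods of `x`, ordered by reverse inclusion. -/
abbrev Nhd (x : X) : Type u := {V : Opens X // x ∈ V}ᵒᵈ

/-- The neighbourhood, as an open set. -/
def Nhd.set {x : X} (V : Nhd x) : Opens X := (OrderDual.ofDual V).1

instance (x : X) : Nonempty (Nhd x) := ⟨OrderDual.toDual ⟨⊤, trivial⟩⟩

instance (x : X) : IsDirectedOrder (Nhd x) where
  directed V W := ⟨OrderDual.toDual ⟨V.set ⊓ W.set,
    (OrderDual.ofDual V).2, (OrderDual.ofDual W).2⟩,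
    show V.set ⊓ W.set ≤ V.set from inf_le_left, show V.set ⊓ W.set ≤ W.set from inf_le_right⟩

/-- The transition maps of the directed system of the `ξ(V)`, `V` an open neighbourhood of `x`. -/
def nhdMap (ξ : (Opens X)ᵒᵖ ⥤ Banc.{u} 𝕜) (x : X) (V W : Nhd x) (h : V ≤ W) :
    ξ.obj (op V.set) →ₗ[𝕜] ξ.obj (op W.set) :=
  (res ξ (show W.set ≤ V.set from h)).toLinearMap

instance (ξ : (Opens X)ᵒᵖ ⥤ Banc.{u} 𝕜) (x : X) :
    DirectedSystem (fun V : Nhd x => ξ.obj (op V.set)) (nhdMap ξ x · · ·) where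
  map_self _ s := res_self ξ s
  map_map _ _ _ h h' s := res_res ξ h h' s

/-- The algebraic direct limit of the vector spaces `ξ(V)`, `V` an open neighbourhood of `x`. -/
def PreStalk (ξ : (Opens X)ᵒᵖ ⥤ Banc.{u} 𝕜) (x : X) : Type u :=
  DirectLimit (fun V : Nhd x => ξ.obj (op V.set)) (nhdMap ξ x)

instance (ξ : (Opens X)ᵒᵖ ⥤ Banc.{u} 𝕜) (x : X) : AddCommGroup (PreStalk ξ x) :=
  inferInstanceAs (AddCommGroup (DirectLimit (fun V : Nhd x => ξ.obj (op V.set)) (nhdMap ξ x)))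

instance (ξ : (Opens X)ᵒᵖ ⥤ Banc.{u} 𝕜) (x : X) : Module 𝕜 (PreStalk ξ x) :=
  inferInstanceAs (Module 𝕜 (DirectLimit (fun V : Nhd x => ξ.obj (op V.set)) (nhdMap ξ x)))

/-- The canonical map from `ξ(V)` to the algebraic direct limit. -/
def preGerm (ξ : (Opens X)ᵒᵖ ⥤ Banc.{u} 𝕜) (x : X) (V : Nhd x) :
    ξ.obj (op V.set) →ₗ[𝕜] PreStalk ξ x :=
  DirectLimit.Module.of 𝕜 (Nhd x) (fun V : Nhd x => ξ.obj (op V.set)) (nhdMap ξ x) V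

lemma preGerm_res (ξ : (Opens X)ᵒᵖ ⥤ Banc.{u} 𝕜) (x : X) {V W : Nhd x} (h : V ≤ W)
    (s : ξ.obj (op V.set)) :
    preGerm ξ x W (res ξ (show W.set ≤ V.set from h) s) = preGerm ξ x V s :=
  DirectLimit.Module.of_f (hij := h)

lemma exists_preGerm_eq (ξ : (Opens X)ᵒᵖ ⥤ Banc.{u} 𝕜) (x : X) (z : PreStalk ξ x) :
    ∃ (V : Nhd x) (s : ξ.obj (op V.set)), preGerm ξ x V s = z := by
  obtain ⟨V, s, h⟩ := DirectLimit.exists_eq_mk (nhdMap ξ x) z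
  exact ⟨V, s, h.symm⟩

/-- The seminorm of the direct limit: the infimum of the norms of all representatives. -/
def preStalkSeminorm (ξ : (Opens X)ᵒᵖ ⥤ Banc.{u} 𝕜) (x : X) : Seminorm 𝕜 (PreStalk ξ x) :=
  Seminorm.ofSMulLE
    (fun z => sInf {r : ℝ | ∃ (V : Nhd x) (s : ξ.obj (op V.set)), preGerm ξ x V s = z ∧ ‖s‖ = r})
    (by
      apply le_antisymm
      · refine csInf_le ⟨0, ?_⟩ ⟨Classical.arbitrary _, 0, map_zero _, norm_zero⟩
        rintro _ ⟨V, s, _, rfl⟩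
        exact norm_nonneg s
      · apply Real.sInf_nonneg
        rintro _ ⟨V, s, _, rfl⟩
        exact norm_nonneg s)
    (by
      intro y z
      obtain ⟨V₀, s₀, h₀⟩ := exists_preGerm_eq ξ x y
      obtain ⟨W₀, t₀, k₀⟩ := exists_preGerm_eq ξ x z
      refine le_of_forall_pos_le_add fun ε hε => ?_
      obtain ⟨_, ⟨V, s, hs, rfl⟩, hs'⟩ := Real.lt_sInf_add_pos
        (s := {r : ℝ | ∃ (V : Nhd x) (s : ξ.obj (op V.set)), preGerm ξ x V s = y ∧ ‖s‖ = r})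
        ⟨_, V₀, s₀, h₀, rfl⟩ (half_pos hε)
      obtain ⟨_, ⟨W, t, ht, rfl⟩, ht'⟩ := Real.lt_sInf_add_pos
        (s := {r : ℝ | ∃ (V : Nhd x) (s : ξ.obj (op V.set)), preGerm ξ x V s = z ∧ ‖s‖ = r})
        ⟨_, W₀, t₀, k₀, rfl⟩ (half_pos hε)
      obtain ⟨N, hVN, hWN⟩ := exists_ge_ge V W
      have key := csInf_le (a := ‖res ξ (show N.set ≤ V.set from hVN) s +
          res ξ (show N.set ≤ W.set from hWN) t‖)
        (s := {r : ℝ | ∃ (V : Nhd x) (s : ξ.obj (op V.set)), preGerm ξ x V s = y + z ∧ ‖s‖ = r})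
        ⟨0, by rintro _ ⟨V, s, _, rfl⟩; exact norm_nonneg s⟩
        ⟨N, _, by rw [map_add, preGerm_res ξ x hVN, preGerm_res ξ x hWN, hs, ht], rfl⟩
      have h1 := norm_add_le (res ξ (show N.set ≤ V.set from hVN) s)
        (res ξ (show N.set ≤ W.set from hWN) t)
      have h2 := norm_res_le ξ (show N.set ≤ V.set from hVN) s
      have h3 := norm_res_le ξ (show N.set ≤ W.set from hWN) t
      linarith)
    (by
      intro k z
      obtain ⟨V₀, s₀, h₀⟩ := exists_preGerm_eq ξ x z
      refine le_of_forall_pos_le_add fun ε hε => ?_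
      have hk : 0 < ‖k‖ + 1 := by positivity
      obtain ⟨_, ⟨V, s, hs, rfl⟩, hs'⟩ := Real.lt_sInf_add_pos
        (s := {r : ℝ | ∃ (V : Nhd x) (s : ξ.obj (op V.set)), preGerm ξ x V s = z ∧ ‖s‖ = r})
        ⟨_, V₀, s₀, h₀, rfl⟩ (div_pos hε hk)
      have key := csInf_le (a := ‖k • s‖)
        (s := {r : ℝ | ∃ (V : Nhd x) (s : ξ.obj (op V.set)), preGerm ξ x V s = k • z ∧ ‖s‖ = r})
        ⟨0, by rintro _ ⟨V, s, _, rfl⟩; exact norm_nonneg s⟩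
        ⟨V, _, by rw [map_smul, hs], rfl⟩
      rw [norm_smul] at key
      have h1 := mul_le_mul_of_nonneg_left hs'.le (norm_nonneg k)
      have h2 : ‖k‖ * (ε / (‖k‖ + 1)) ≤ ε := by
        rw [mul_div_assoc', div_le_iff₀ hk]
        nlinarith
      rw [mul_add] at h1
      linarith)

instance (ξ : (Opens X)ᵒᵖ ⥤ Banc.{u} 𝕜) (x : X) : SeminormedAddCommGroup (PreStalk ξ x) :=
  (preStalkSeminorm ξ x).toSeminormedAddCommGroup

instance (ξ : (Opens X)ᵒᵖ ⥤ Banc.{u} 𝕜) (x : X) : NormedSpace 𝕜 (PreStalk ξ x) where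
  norm_smul_le k z := (map_smul_eq_mul (preStalkSeminorm ξ x) k z).le

/-- The stalk of `ξ` at `x`: the colimit, in `Banc 𝕜`, of the `ξ(V)` over the open neighbourhoods
`V` of `x`. It is the Hausdorff completion of the algebraic direct limit. -/
abbrev Stalk (ξ : (Opens X)ᵒᵖ ⥤ Banc.{u} 𝕜) (x : X) : Type u :=
  UniformSpace.Completion (PreStalk ξ x)

/-- The germ at `x` of a section `s ∈ ξ(V)`, for `x ∈ V`. -/
def germ (ξ : (Opens X)ᵒᵖ ⥤ Banc.{u} 𝕜) {V : Opens X} {x : X} (hx : x ∈ V)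
    (s : ξ.obj (op V)) : Stalk ξ x :=
  ((preGerm ξ x (OrderDual.toDual ⟨V, hx⟩) s : PreStalk ξ x) : Stalk ξ x)

lemma norm_germ_le (ξ : (Opens X)ᵒᵖ ⥤ Banc.{u} 𝕜) {V : Opens X} {x : X} (hx : x ∈ V)
    (s : ξ.obj (op V)) : ‖germ ξ hx s‖ ≤ ‖s‖ := by
  rw [germ, UniformSpace.Completion.norm_coe]
  exact csInf_le ⟨0, by rintro _ ⟨V, s, _, rfl⟩; exact norm_nonneg s⟩
    ⟨OrderDual.toDual ⟨V, hx⟩, s, rfl, rfl⟩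

/-- `ξ^(U) = ∏_{x ∈ U} ξ_x`, the product in `Banc 𝕜`: bounded families with the sup norm. -/
abbrev Etal (ξ : (Opens X)ᵒᵖ ⥤ Banc.{u} 𝕜) (U : Opens X) : Type u :=
  lp (fun x : U => Stalk ξ x.1) ∞

/-- The restriction maps of `ξ^`. -/
def Etal.res (ξ : (Opens X)ᵒᵖ ⥤ Banc.{u} 𝕜) {U V : Opens X} (h : V ≤ U) (t : Etal ξ U) :
    Etal ξ V :=
  ⟨fun x => t ⟨x.1, h x.2⟩, memℓp_infty ⟨‖t‖, by
    rintro _ ⟨x, rfl⟩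
    exact lp.norm_apply_le_norm ENNReal.top_ne_zero t ⟨x.1, h x.2⟩⟩⟩

/-- The canonical map `ξ(U) → ξ^(U)`, sending a section to the family of its germs. -/
def toEtal (ξ : (Opens X)ᵒᵖ ⥤ Banc.{u} 𝕜) (U : Opens X) (s : ξ.obj (op U)) : Etal ξ U :=
  ⟨fun x => germ ξ x.2 s, memℓp_infty ⟨‖s‖, by
    rintro _ ⟨x, rfl⟩
    exact norm_germ_le ξ x.2 s⟩⟩

/-- A presheaf of Banach spaces on `X` is a Banach sheaf if it satisfies uniqueness of patching
and the approximation condition. (The supremum over an empty cover is `0`.) -/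
structure IsBanachSheaf (ξ : (Opens X)ᵒᵖ ⥤ Banc.{u} 𝕜) : Prop where
  uniqueness : ∀ (U : Opens X) (𝒰 : Set (Opens X)) (h : sSup 𝒰 = U) (s : ξ.obj (op U)),
    ‖s‖ = ⨆ V : 𝒰, ‖res ξ (h ▸ le_sSup V.2 : V.1 ≤ U) s‖
  approximation : ∀ (U : Opens X) (t : Etal ξ U),
    (∀ ε : ℝ, 0 < ε → ∀ x ∈ U, ∃ (V : Opens X) (h : V ≤ U) (s : ξ.obj (op V)),
      x ∈ V ∧ ‖Etal.res ξ h t - toEtal ξ V s‖ < ε) →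
    ∃ σ : ξ.obj (op U), t = toEtal ξ U σ

variable (𝕜 X) in
/-- The category of Banach sheaves on `X` (with contractive natural transformations). -/
abbrev BanachShv := ObjectProperty.FullSubcategory
  (fun ξ : (Opens X)ᵒᵖ ⥤ Banc.{u} 𝕜 => IsBanachSheaf ξ)

end Top

/-! ### The finite Grothendieck topology on a Boolean algebra -/

/-- A sieve on `E` is covering if it contains a finite family with supremum `E`. -/
def finiteTopology (Ω : Type u) [BooleanAlgebra Ω] : GrothendieckTopology Ω where
  sieves E := {S | ∃ t : Finset Ω, t.sup id = E ∧ ∀ F ∈ t, ∃ h : F ≤ E, S (homOfLE h)}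
  top_mem' E := ⟨{E}, by simp, by simp⟩
  pullback_stable' := by
    classical
    rintro E E' S f ⟨t, ht, hS⟩
    refine ⟨t.image (fun F => E' ⊓ F), ?_, ?_⟩
    · have hd := Finset.sup_inf_distrib_left t id E'
      simp only [id] at hd
      rw [Finset.sup_image, Function.id_comp, ← hd, ht]
      exact inf_eq_left.2 (leOfHom f)
    · intro F hF
      obtain ⟨G, hG, rfl⟩ := Finset.mem_image.1 hF
      obtain ⟨h, hSG⟩ := hS G hG
      exact ⟨inf_le_left, S.downward_closed hSG (homOfLE inf_le_right)⟩
  transitive' := by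
    classical
    rintro E S ⟨t, ht, hS⟩ R hR
    have key : ∀ F ∈ t, ∃ r : Finset Ω, r.sup id = F ∧
        ∀ G ∈ r, ∃ h : G ≤ E, R (homOfLE h) := by
      intro F hF
      obtain ⟨h, hSF⟩ := hS F hF
      obtain ⟨r, hr, hRr⟩ := hR hSF
      exact ⟨r, hr, fun G hG => ⟨(hRr G hG).1.trans h, (hRr G hG).2⟩⟩
    choose! r hr hr' using key
    refine ⟨t.biUnion r, ?_, ?_⟩
    · rw [Finset.sup_biUnion, ← ht]
      exact Finset.sup_congr rfl hr
    · intro G hG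
      obtain ⟨F, hF, hGF⟩ := Finset.mem_biUnion.1 hG
      exact hr' F hF G hGF

/-! ### The Stone space of a Boolean algebra -/

/-- The Stone space of `Ω`: the ultrafilters of `Ω`, as morphisms of Boolean algebras
`x : Ω → {0, 1}`. -/
structure Stone (Ω : Type u) [BooleanAlgebra Ω] where
  hom : BoundedLatticeHom Ω Bool

section Stone

variable (Ω : Type u) [BooleanAlgebra Ω]

/-- The topology with base the sets `{x | x(E) = 1}`, `E ∈ Ω`. -/
instance : TopologicalSpace (Stone Ω) :=
  TopologicalSpace.generateFrom (Set.range fun E : Ω => {x : Stone Ω | x.hom E = true})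

variable {Ω}

lemma Stone.isOpen_setOf (E : Ω) : IsOpen {x : Stone Ω | x.hom E = true} :=
  TopologicalSpace.isOpen_generateFrom_of_mem ⟨E, rfl⟩

lemma Stone.setOf_compl (E : Ω) :
    {x : Stone Ω | x.hom Eᶜ = true} = {x : Stone Ω | x.hom E = true}ᶜ := by
  ext x
  simp

lemma Stone.isClopen_setOf (E : Ω) : IsClopen {x : Stone Ω | x.hom E = true} :=
  ⟨⟨by rw [← Stone.setOf_compl]; exact Stone.isOpen_setOf Eᶜ⟩, Stone.isOpen_setOf E⟩

lemma Stone.isTopologicalBasis : TopologicalSpace.IsTopologicalBasis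
    (Set.range fun E : Ω => {x : Stone Ω | x.hom E = true}) where
  exists_subset_inter := by
    rintro _ ⟨E, rfl⟩ _ ⟨F, rfl⟩ x ⟨hE, hF⟩
    refine ⟨_, ⟨E ⊓ F, rfl⟩, ?_, ?_⟩
    · simp_all
    · intro y hy
      simpa using hy
  sUnion_eq := Set.eq_univ_of_forall fun x => ⟨_, ⟨⊤, rfl⟩, map_top x.hom⟩
  eq_generateFrom := rfl

instance : CompactSpace (Stone Ω) := by
  let e : Stone Ω → (Ω → Bool) := fun x E => x.hom E
  have hcont : Continuous e := by
    refine continuous_pi fun E => continuous_discrete_rng.2 fun b => ?_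
    cases b
    · convert Stone.isOpen_setOf Eᶜ using 1
      rw [Stone.setOf_compl]
      ext x
      simp [e]
    · exact Stone.isOpen_setOf E
  have hind : Topology.IsInducing e := by
    refine ⟨le_antisymm (continuous_iff_le_induced.1 hcont) ?_⟩
    refine le_generateFrom ?_
    rintro _ ⟨E, rfl⟩
    exact ⟨(fun f : Ω → Bool => f E) ⁻¹' {true},
      (isOpen_discrete _).preimage (continuous_apply E), rfl⟩
  have hinj : Function.Injective e := by
    rintro ⟨x⟩ ⟨y⟩ h
    congr 1
    ext E
    exact congrFun h E
  have hrange : Set.range e = {f | f ⊤ = ⊤ ∧ f ⊥ = ⊥ ∧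
      ∀ E F, f (E ⊔ F) = f E ⊔ f F ∧ f (E ⊓ F) = f E ⊓ f F} := by
    ext f
    constructor
    · rintro ⟨x, rfl⟩
      exact ⟨map_top x.hom, map_bot x.hom, fun E F => ⟨map_sup x.hom E F, map_inf x.hom E F⟩⟩
    · rintro ⟨h1, h0, h⟩
      exact ⟨⟨⟨⟨⟨f, fun E F => (h E F).1⟩, fun E F => (h E F).2⟩, h1, h0⟩⟩, rfl⟩
  have hclosed : IsClosed (Set.range e) := by
    rw [hrange]
    simp only [Set.ofPred_and, Set.ofPred_forall]
    have hs : Continuous fun p : Bool × Bool => p.1 ⊔ p.2 :=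
      continuous_of_discreteTopology
    have hi : Continuous fun p : Bool × Bool => p.1 ⊓ p.2 :=
      continuous_of_discreteTopology
    refine (isClosed_eq (continuous_apply _) continuous_const).inter
      ((isClosed_eq (continuous_apply _) continuous_const).inter
        (isClosed_iInter fun E => isClosed_iInter fun F => ?_))
    have hs' : Continuous fun f : Ω → Bool => f E ⊔ f F :=
      hs.comp (f := fun f : Ω → Bool => (f E, f F))
        ((continuous_apply E).prodMk (continuous_apply F))
    have hi' : Continuous fun f : Ω → Bool => f E ⊓ f F :=
      hi.comp (f := fun f : Ω → Bool => (f E, f F))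
        ((continuous_apply E).prodMk (continuous_apply F))
    exact (isClosed_eq (continuous_apply _) hs').inter (isClosed_eq (continuous_apply _) hi')
  exact (Topology.IsClosedEmbedding.mk ⟨hind, hinj⟩ hclosed).compactSpace

lemma Stone.exists_of_not_le {E F : Ω} (h : ¬ E ≤ F) :
    ∃ x : Stone Ω, x.hom E = true ∧ x.hom F = false := by
  classical
  obtain ⟨J, hJ, hFJ, hd⟩ := DistribLattice.prime_ideal_of_disjoint_filter_ideal
    (F := Order.PFilter.principal E) (I := Order.Ideal.principal F) (by
      rw [Set.disjoint_left]
      intro G hG hG'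
      exact h (le_trans (Order.PFilter.mem_principal.1 hG) (Order.Ideal.mem_principal.1 hG')))
  have hE : E ∉ J := fun hE => Set.disjoint_left.1 hd (Order.PFilter.mem_principal.2 le_rfl) hE
  have hF : F ∈ J := hFJ (Order.Ideal.mem_principal.2 le_rfl)
  have htop : (⊤ : Ω) ∉ J := fun ht => hE (J.lower le_top ht)
  have hinf : ∀ {G H : Ω}, G ⊓ H ∈ J ↔ G ∈ J ∨ H ∈ J := by
    intro G H
    exact ⟨fun hGH => hJ.mem_or_mem hGH,
      fun hGH => hGH.elim (fun k => J.lower inf_le_left k) (fun k => J.lower inf_le_right k)⟩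
  refine ⟨⟨⟨⟨⟨fun G => decide (G ∉ J), fun G H => ?_⟩, fun G H => ?_⟩, ?_, ?_⟩⟩, ?_, ?_⟩
  · rw [Bool.eq_iff_iff]
    simp [Order.Ideal.sup_mem_iff, imp_iff_not_or]
  · rw [Bool.eq_iff_iff]
    simp [hinf]
  · simp [htop]
  · simp
  · exact decide_eq_true hE
  · exact decide_eq_false (not_not.2 hF)

lemma Stone.exists_eq_of_isClopen {C : Set (Stone Ω)} (hC : IsClopen C) :
    ∃ E : Ω, {x : Stone Ω | x.hom E = true} = C := by
  classical
  obtain ⟨t, ht⟩ := hC.isClosed.isCompact.elim_finite_subcover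
    (fun E : {E : Ω // {x : Stone Ω | x.hom E = true} ⊆ C} => {x : Stone Ω | x.hom E = true})
    (fun E => Stone.isOpen_setOf E.1) (by
      intro x hx
      obtain ⟨_, ⟨E, rfl⟩, hxE, hE⟩ :=
        Stone.isTopologicalBasis.exists_subset_of_mem_open hx hC.isOpen
      exact Set.mem_iUnion.2 ⟨⟨E, hE⟩, hxE⟩)
  have hsup : ∀ x : Stone Ω, x.hom (t.sup Subtype.val) = true ↔ ∃ E ∈ t, x.hom E.1 = true := by
    intro x
    rw [map_finset_sup]
    clear ht
    induction t using Finset.induction_on with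
    | empty => simp
    | insert a s ha ih => simpa using or_congr_right ih
  refine ⟨t.sup Subtype.val, Set.Subset.antisymm ?_ ?_⟩
  · intro x hx
    obtain ⟨E, -, hE⟩ := (hsup x).1 hx
    exact E.2 hE
  · intro x hx
    obtain ⟨E, hEt, hE⟩ := Set.mem_iUnion₂.1 (ht hx)
    exact (hsup x).2 ⟨E, hEt, hE⟩

variable (Ω)

/-- The Stone isomorphism `η : Ω ≅ Clopen(X)`, `η(E) = {x | x(E) = 1}`, for `X` the Stone space
of `Ω`. -/
def stoneIso : Ω ≃o Clopens (Stone Ω) where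
  toEquiv := Equiv.ofBijective (fun E => ⟨{x | x.hom E = true}, Stone.isClopen_setOf E⟩) (by
    constructor
    · intro E F h
      have h' : ∀ x : Stone Ω, x.hom E = true ↔ x.hom F = true := fun x =>
        Set.ext_iff.1 (congrArg (fun C : Clopens (Stone Ω) => (C : Set (Stone Ω))) h) x
      by_contra hne
      rcases not_and_or.1 (fun k : E ≤ F ∧ F ≤ E => hne (le_antisymm k.1 k.2)) with k | k
      · obtain ⟨x, hx, hx'⟩ := Stone.exists_of_not_le k
        simp [(h' x).1 hx] at hx'
      · obtain ⟨x, hx, hx'⟩ := Stone.exists_of_not_le k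
        simp [(h' x).2 hx] at hx'
    · intro C
      obtain ⟨E, hE⟩ := Stone.exists_eq_of_isClopen C.isClopen
      exact ⟨E, SetLike.coe_injective hE⟩)
  map_rel_iff' := by
    intro E F
    constructor
    · intro h
      by_contra k
      obtain ⟨x, hx, hx'⟩ := Stone.exists_of_not_le k
      have hF : x.hom F = true := h hx
      simp [hF] at hx'
    · intro h x hx
      exact le_antisymm le_top ((le_of_eq (Eq.symm hx)).trans (OrderHomClass.mono x.hom h))

lemma mem_stoneIso (E : Ω) (x : Stone Ω) : x ∈ stoneIso Ω E ↔ x.hom E = true := Iff.rfl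

/-- `η`, as a functor from `Ω` to the open subsets of its Stone space. -/
def stoneFunctor : Ω ⥤ Opens (Stone Ω) :=
  Monotone.functor (f := fun E => (stoneIso Ω E).toOpens) fun _ _ h =>
    (stoneIso Ω).monotone h

variable (𝕜 : Type*) [RCLike 𝕜]

/-- The functor `ξ ↦ η*(ξ)`, `η*(ξ)(E) = ξ(η(E))`, from presheaves on the Stone space of `Ω` to
presheaves on `Ω`. -/
def stonePullback : ((Opens (Stone Ω))ᵒᵖ ⥤ Banc.{u} 𝕜) ⥤ (Ωᵒᵖ ⥤ Banc.{u} 𝕜) :=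
  (Functor.whiskeringLeft _ _ _).obj (stoneFunctor Ω).op

/-- The functor `ξ ↦ η*(ξ)` from Banach sheaves on the Stone space of `Ω` to sheaves on `Ω` for the
finite topology, once it is known that `η*` takes the former to the latter. -/
def stonePullbackShv
    (h : ∀ ξ : (Opens (Stone Ω))ᵒᵖ ⥤ Banc.{u} 𝕜, IsBanachSheaf ξ →
      Presheaf.IsSheaf (finiteTopology Ω) ((stonePullback Ω 𝕜).obj ξ)) :
    BanachShv 𝕜 (Stone Ω) ⥤ Sheaf (finiteTopology Ω) (Banc.{u} 𝕜) :=
  ObjectProperty.lift _ (ObjectProperty.ι _ ⋙ stonePullback Ω 𝕜) fun ξ => h ξ.obj ξ.property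

/-- The action of `η*` on bounded natural transformations: `η*(τ)_E = τ_{η(E)}`. -/
def stonePullbackBdd (ξ ζ : (Opens (Stone Ω))ᵒᵖ ⥤ Banc.{u} 𝕜) :
    BddNat ξ ζ →ₗ[𝕜] BddNat ((stonePullback Ω 𝕜).obj ξ) ((stonePullback Ω 𝕜).obj ζ) :=
  BddNat.whisker (stoneFunctor Ω).op ξ ζ

end Stone

end BanachSheaf

end

/-!
A section of a Banach sheaf is controlled by its germs: uniqueness of patching says that the norm
is a local quantity, so `‖s‖` is the supremum of the norms of the germs of `s`
(`IsLocallyNormed.norm_le_of_norm_germ_le`), and the approximation condition, applied with error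
`0`, patches any bounded family of sections with equal germs (`IsBanachSheaf.exists_glue_clm`).
Patching over a finite cover by clopen sets gives the sheaf property of `η*(ξ)`
(`isSheaf_stonePullback`). Since the clopen sets form a base of the Stone space, a bounded natural
transformation is determined, together with its norm, by its components over the clopen sets
(`norm_stonePullbackBdd`), and any bounded family of such components extends to all open sets by
patching (`exists_stonePullbackBdd_eq`). Contractive natural transformations are the bounded ones
of norm at most one, so `η*` is fully faithful on Banach sheaves.

For essential surjectivity, a sheaf `F` on `Ω` is extended to `X` by letting the sections over `U`
be the bounded compatible families `(s_E)` with `s_E ∈ F(E)` and `η(E) ⊆ U`. Over `η(E)` such a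
family amounts to an element of `F(E)`, so `η*` of the extension is `F`
(`stonePullbackExtendIso`). That the extension is a Banach sheaf (`isBanachSheaf_extend`) rests on
the compactness of the clopen sets, used through the induction principle `clopen_induction`, and on
the sheaf property of `F` in the form `F(⊥) = 0` and `F(E ⊔ G) = F(E) × F(G)` for disjoint `E` and
`G`. For the approximation condition, local approximations over finitely many disjoint clopen sets
are patched in `F`; the resulting approximations over a given `η(E)` form a Cauchy sequence, whose
limit has the prescribed germs.
-/

noncomputable section

namespace BanachSheaf

/-! ### Germs of sections -/

section Germ

variable {𝕜 : Type*} [RCLike 𝕜] {X : Type u} [TopologicalSpace X]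
  (ξ : (Opens X)ᵒᵖ ⥤ Banc.{u} 𝕜)

lemma germ_res {U V : Opens X} (h : V ≤ U) {x : X} (hx : x ∈ V) (s : ξ.obj (op U)) :
    germ ξ hx (res ξ h s) = germ ξ (h hx) s := by
  have e := preGerm_res ξ x (V := OrderDual.toDual ⟨U, h hx⟩) (W := OrderDual.toDual ⟨V, hx⟩) h s
  exact congrArg (fun z : PreStalk ξ x => (z : Stalk ξ x)) e

lemma germ_sub {V : Opens X} {x : X} (hx : x ∈ V) (s t : ξ.obj (op V)) :
    germ ξ hx (s - t) = germ ξ hx s - germ ξ hx t := by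
  have h : preGerm ξ x (OrderDual.toDual ⟨V, hx⟩) (s - t) =
      preGerm ξ x (OrderDual.toDual ⟨V, hx⟩) s - preGerm ξ x (OrderDual.toDual ⟨V, hx⟩) t :=
    map_sub (preGerm ξ x (OrderDual.toDual ⟨V, hx⟩)) s t
  rw [germ, germ, germ, h, UniformSpace.Completion.coe_sub]

lemma continuous_germ {V : Opens X} {x : X} (hx : x ∈ V) :
    Continuous (germ ξ hx : ξ.obj (op V) → Stalk ξ x) := by
  refine (LipschitzWith.of_dist_le_mul (K := 1) fun s t => ?_).continuous
  rw [dist_eq_norm, dist_eq_norm, ← germ_sub, NNReal.coe_one, one_mul]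
  exact norm_germ_le ξ hx _

/-- The seminorm of the stalk is an infimum over all representatives of a germ, and any two
representatives agree on a smaller neighbourhood. -/
lemma exists_norm_res_lt_of_norm_germ_lt {V : Opens X} {x : X} (hx : x ∈ V) (s : ξ.obj (op V))
    {r : ℝ} (hr : ‖germ ξ hx s‖ < r) :
    ∃ (W : Opens X) (h : W ≤ V), x ∈ W ∧ ‖res ξ h s‖ < r := by
  rw [germ, UniformSpace.Completion.norm_coe] at hr
  obtain ⟨_, ⟨W, t, ht, rfl⟩, hlt⟩ := exists_lt_of_csInf_lt (s := {r : ℝ | ∃ (W : Nhd x)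
      (t : ξ.obj (op W.set)), preGerm ξ x W t = preGerm ξ x (OrderDual.toDual ⟨V, hx⟩) s ∧
        ‖t‖ = r}) ⟨_, OrderDual.toDual ⟨V, hx⟩, s, rfl, rfl⟩ hr
  obtain ⟨N, hWN, hVN, hN⟩ := Quotient.eq.mp ht
  refine ⟨N.set, hVN, (OrderDual.ofDual N).2, ?_⟩
  have hN' : res ξ (show N.set ≤ W.set from hWN) t = res ξ (show N.set ≤ V from hVN) s := hN
  rw [← hN']
  exact (norm_res_le ξ _ t).trans_lt hlt

/-- The norm of a section is determined locally. This is the uniqueness of patching, in a form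
which avoids suprema. -/
def IsLocallyNormed : Prop :=
  ∀ (U : Opens X) (s : ξ.obj (op U)) (r : ℝ), 0 ≤ r →
    (∀ x ∈ U, ∃ (W : Opens X) (h : W ≤ U), x ∈ W ∧ ‖res ξ h s‖ ≤ r) → ‖s‖ ≤ r

variable {ξ}

lemma IsBanachSheaf.isLocallyNormed (hξ : IsBanachSheaf ξ) : IsLocallyNormed ξ := by
  intro U s r hr h
  have hsup : sSup {W : Opens X | ∃ h : W ≤ U, ‖res ξ h s‖ ≤ r} = U := by
    refine le_antisymm (sSup_le fun W hW => hW.1) fun x hx => ?_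
    obtain ⟨W, hWU, hxW, hW⟩ := h x hx
    exact Opens.mem_sSup.2 ⟨W, ⟨hWU, hW⟩, hxW⟩
  rw [hξ.uniqueness U _ hsup s]
  exact Real.iSup_le (fun V => V.2.2) hr

lemma IsLocallyNormed.uniqueness (hξ : IsLocallyNormed ξ) (U : Opens X) (𝒰 : Set (Opens X))
    (h : sSup 𝒰 = U) (s : ξ.obj (op U)) :
    ‖s‖ = ⨆ V : 𝒰, ‖res ξ (h ▸ le_sSup V.2 : V.1 ≤ U) s‖ := by
  -- The real supremum of an unbounded family would be `0`.
  have hb : BddAbove (Set.range fun V : 𝒰 => ‖res ξ (h ▸ le_sSup V.2 : V.1 ≤ U) s‖) :=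
    ⟨‖s‖, by rintro _ ⟨V, rfl⟩; exact norm_res_le ξ _ s⟩
  refine le_antisymm (hξ U s _ (Real.iSup_nonneg fun _ => norm_nonneg _) fun x hx => ?_)
    (Real.iSup_le (fun V => norm_res_le ξ _ s) (norm_nonneg s))
  obtain ⟨V, hV, hxV⟩ := Opens.mem_sSup.1 (h.symm ▸ hx : x ∈ sSup 𝒰)
  exact ⟨V, h ▸ le_sSup hV, hxV, le_ciSup hb ⟨V, hV⟩⟩

lemma IsLocallyNormed.norm_le_of_norm_germ_le (hξ : IsLocallyNormed ξ) {U : Opens X}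
    (s : ξ.obj (op U)) {r : ℝ} (hr : 0 ≤ r) (h : ∀ (x : X) (hx : x ∈ U), ‖germ ξ hx s‖ ≤ r) :
    ‖s‖ ≤ r := by
  refine le_of_forall_pos_le_add fun ε hε => hξ U s _ (by positivity) fun x hx => ?_
  obtain ⟨W, hW, hxW, hlt⟩ :=
    exists_norm_res_lt_of_norm_germ_lt ξ hx s ((h x hx).trans_lt (lt_add_of_pos_right r hε))
  exact ⟨W, hW, hxW, hlt.le⟩

lemma IsLocallyNormed.germ_ext (hξ : IsLocallyNormed ξ) {U : Opens X} {s t : ξ.obj (op U)}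
    (h : ∀ (x : X) (hx : x ∈ U), germ ξ hx s = germ ξ hx t) : s = t := by
  rw [← sub_eq_zero, ← norm_le_zero_iff]
  refine hξ.norm_le_of_norm_germ_le _ le_rfl fun x hx => ?_
  rw [germ_sub, h, sub_self, norm_zero]

lemma IsLocallyNormed.res_ext (hξ : IsLocallyNormed ξ) {ι : Type*} {U : Opens X} {V : ι → Opens X}
    (hV : ∀ i, V i ≤ U) (hU : ∀ x ∈ U, ∃ i, x ∈ V i) {s t : ξ.obj (op U)}
    (h : ∀ i, res ξ (hV i) s = res ξ (hV i) t) : s = t := by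
  refine hξ.germ_ext fun x hx => ?_
  obtain ⟨i, hi⟩ := hU x hx
  rw [← germ_res ξ (hV i) hi, h, germ_res]

/-- Bounded families of sections of a Banach sheaf with equal germs can be patched: the common
germs form a family to which the approximation condition applies, with error `0`. -/
lemma IsBanachSheaf.exists_glue (hξ : IsBanachSheaf ξ) {ι : Type*} {U : Opens X} {V : ι → Opens X}
    (hV : ∀ i, V i ≤ U) (hU : ∀ x ∈ U, ∃ i, x ∈ V i) (s : ∀ i, ξ.obj (op (V i))) (M : ℝ)
    (hM : ∀ i, ‖s i‖ ≤ M)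
    (hs : ∀ (i j : ι) (x : X) (hi : x ∈ V i) (hj : x ∈ V j), germ ξ hi (s i) = germ ξ hj (s j)) :
    ∃ σ : ξ.obj (op U), ∀ i, res ξ (hV i) σ = s i := by
  choose i hi using fun x : U => hU x.1 x.2
  let t : Etal ξ U := ⟨fun x => germ ξ (hi x) (s (i x)), memℓp_infty ⟨M, by
    rintro _ ⟨x, rfl⟩
    exact (norm_germ_le ξ _ _).trans (hM _)⟩⟩
  obtain ⟨σ, hσ⟩ := hξ.approximation U t (by
    intro ε hε x hx
    refine ⟨V (i ⟨x, hx⟩), hV _, s (i ⟨x, hx⟩), hi ⟨x, hx⟩, ?_⟩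
    -- Near `x` the family `t` consists of the germs of a single section, so the error is `0`.
    have h0 : Etal.res ξ (hV (i ⟨x, hx⟩)) t - toEtal ξ (V (i ⟨x, hx⟩)) (s (i ⟨x, hx⟩)) = 0 := by
      ext y
      exact sub_eq_zero.2 (hs _ _ _ _ _)
    rwa [h0, norm_zero])
  refine ⟨σ, fun j => hξ.isLocallyNormed.germ_ext fun x hx => ?_⟩
  have h : germ ξ (hi ⟨x, hV j hx⟩) (s (i ⟨x, hV j hx⟩)) = germ ξ (hV j hx) σ :=
    congrArg (fun t : Etal ξ U => t ⟨x, hV j hx⟩) hσ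
  rw [germ_res, ← h]
  exact hs _ _ _ _ _

/-- A uniformly bounded family of linear maps into the sections of a Banach sheaf over the members
of an open cover, compatible on overlaps, can be patched to a linear map with the same bound. -/
lemma IsBanachSheaf.exists_glue_clm (hξ : IsBanachSheaf ξ) {ι : Type*} {U : Opens X}
    {V : ι → Opens X} (hV : ∀ i, V i ≤ U) (hU : ∀ x ∈ U, ∃ i, x ∈ V i) {A : Type*}
    [NormedAddCommGroup A] [NormedSpace 𝕜 A] (φ : ∀ i, A →L[𝕜] ξ.obj (op (V i))) {M : ℝ}
    (hM0 : 0 ≤ M) (hM : ∀ i, ‖φ i‖ ≤ M)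
    (hφ : ∀ (i j : ι) (x : X) (hi : x ∈ V i) (hj : x ∈ V j) (a : A),
      germ ξ hi (φ i a) = germ ξ hj (φ j a)) :
    ∃ Φ : A →L[𝕜] ξ.obj (op U), ‖Φ‖ ≤ M ∧ ∀ i a, res ξ (hV i) (Φ a) = φ i a := by
  have hb : ∀ a i, ‖φ i a‖ ≤ M * ‖a‖ := fun a i => (φ i).le_of_opNorm_le (hM i) a
  choose f hf using fun a : A => hξ.exists_glue hV hU (fun i => φ i a) (M * ‖a‖) (hb a)
    fun i j x hi hj => hφ i j x hi hj a
  let L : A →ₗ[𝕜] ξ.obj (op U) :=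
    { toFun := f
      map_add' := fun a b => hξ.isLocallyNormed.res_ext hV hU fun i => by simp [hf]
      map_smul' := fun k a => hξ.isLocallyNormed.res_ext hV hU fun i => by simp [hf] }
  have hL : ∀ a, ‖L a‖ ≤ M * ‖a‖ := by
    intro a
    refine hξ.isLocallyNormed U _ _ (by positivity) fun x hx => ?_
    obtain ⟨i, hi⟩ := hU x hx
    exact ⟨V i, hV i, hi, (congrArg norm (hf a i)).trans_le (hb a i)⟩
  exact ⟨L.mkContinuous M hL, L.mkContinuous_norm_le hM0 hL, fun i a => hf a i⟩

end Germ

/-! ### Morphisms of Banach spaces and bounded natural transformations -/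

section Banc

variable {𝕜 : Type*} [RCLike 𝕜]

/-- A continuous linear map of norm at most one, as a morphism of `Banc 𝕜`. -/
def Banc.ofCLM {A B : Banc.{u} 𝕜} (f : A →L[𝕜] B) (hf : ‖f‖ ≤ 1) : A ⟶ B :=
  Banc.Hom.mk f hf

lemma Banc.norm_clm_le {A B : Banc.{u} 𝕜} (f : A ⟶ B) : ‖Banc.clm f‖ ≤ 1 :=
  Banc.Hom.norm_le_one f

lemma Banc.hom_ext {A B : Banc.{u} 𝕜} {f g : A ⟶ B} (h : ∀ a, Banc.clm f a = Banc.clm g a) :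
    f = g :=
  Banc.Hom.ext (ContinuousLinearMap.ext h)

variable {C : Type*} [Category C] {F G : C ⥤ Banc.{u} 𝕜}

/-- A contractive natural transformation is a bounded natural transformation. -/
def BddNat.ofNatTrans (α : F ⟶ G) : BddNat F G :=
  ⟨⟨fun c => Banc.clm (α.app c), memℓp_infty ⟨1, by
      rintro _ ⟨c, rfl⟩
      exact Banc.norm_clm_le _⟩⟩,
    fun _ _ f a => (congrArg (fun φ => Banc.clm φ a) (α.naturality f)).symm⟩

lemma BddNat.norm_ofNatTrans_le (α : F ⟶ G) : ‖BddNat.ofNatTrans α‖ ≤ 1 :=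
  lp.norm_le_of_forall_le zero_le_one fun c => Banc.norm_clm_le (α.app c)

lemma BddNat.norm_apply_le (τ : BddNat F G) (c : C) : ‖τ.1 c‖ ≤ ‖τ‖ :=
  lp.norm_apply_le_norm ENNReal.top_ne_zero τ.1 c

/-- A bounded natural transformation of norm at most one is contractive. -/
def BddNat.toNatTrans (τ : BddNat F G) (hτ : ‖τ‖ ≤ 1) : F ⟶ G where
  app c := Banc.ofCLM (τ.1 c) ((BddNat.norm_apply_le τ c).trans hτ)
  naturality _ _ f := Banc.hom_ext fun a => (τ.2 f a).symm

end Banc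

/-! ### The pullback along the Stone isomorphism -/

section Pullback

variable {𝕜 : Type*} [RCLike 𝕜] {Ω : Type u} [BooleanAlgebra Ω]

lemma mem_stoneFunctor {E : Ω} {x : Stone Ω} : x ∈ (stoneFunctor Ω).obj E ↔ x.hom E = true :=
  Iff.rfl

lemma stoneFunctor_mono {E F : Ω} (h : E ≤ F) : (stoneFunctor Ω).obj E ≤ (stoneFunctor Ω).obj F :=
  leOfHom ((stoneFunctor Ω).map (homOfLE h))

lemma mem_stoneFunctor_inf {E F : Ω} {x : Stone Ω} : x ∈ (stoneFunctor Ω).obj (E ⊓ F) ↔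
    x ∈ (stoneFunctor Ω).obj E ∧ x ∈ (stoneFunctor Ω).obj F := by
  simp [mem_stoneFunctor]

lemma mem_stoneFunctor_sup {E F : Ω} {x : Stone Ω} : x ∈ (stoneFunctor Ω).obj (E ⊔ F) ↔
    x ∈ (stoneFunctor Ω).obj E ∨ x ∈ (stoneFunctor Ω).obj F := by
  simp [mem_stoneFunctor]

lemma notMem_stoneFunctor_bot {x : Stone Ω} : x ∉ (stoneFunctor Ω).obj (⊥ : Ω) := by
  simp [mem_stoneFunctor]

lemma mem_stoneFunctor_finset_sup {t : Finset Ω} {x : Stone Ω} :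
    x ∈ (stoneFunctor Ω).obj (t.sup id) ↔ ∃ E ∈ t, x ∈ (stoneFunctor Ω).obj E := by
  classical
  induction t using Finset.induction_on with
  | empty => simp [notMem_stoneFunctor_bot]
  | insert a s ha ih => simp [mem_stoneFunctor_sup, ih]

lemma exists_mem_stoneFunctor_le {U : Opens (Stone Ω)} {x : Stone Ω} (hx : x ∈ U) :
    ∃ E : Ω, x ∈ (stoneFunctor Ω).obj E ∧ (stoneFunctor Ω).obj E ≤ U := by
  obtain ⟨_, ⟨E, rfl⟩, hxE, hE⟩ := Stone.isTopologicalBasis.exists_subset_of_mem_open hx U.isOpen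
  exact ⟨E, hxE, hE⟩

lemma isSheaf_stonePullback {ξ : (Opens (Stone Ω))ᵒᵖ ⥤ Banc.{u} 𝕜} (hξ : IsBanachSheaf ξ) :
    Presheaf.IsSheaf (finiteTopology Ω) ((stonePullback Ω 𝕜).obj ξ) := by
  rintro A E S ⟨t, ht, hS⟩ x hx
  -- Patching takes place over the whole sieve, which contains all overlaps of its members; the
  -- finite family only serves to see that it covers.
  let ι := {K : Ω // ∃ h : K ≤ E, S (homOfLE h)}
  let V : ι → Opens (Stone Ω) := fun K => (stoneFunctor Ω).obj K.1
  let φ : ∀ K : ι, A →L[𝕜] ξ.obj (op (V K)) := fun K => Banc.clm (x (homOfLE K.2.1) K.2.2)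
  have hV : ∀ K : ι, V K ≤ (stoneFunctor Ω).obj E := fun K => stoneFunctor_mono K.2.1
  have hU : ∀ y ∈ (stoneFunctor Ω).obj E, ∃ K, y ∈ V K := by
    intro y hy
    obtain ⟨K, hK, hyK⟩ := mem_stoneFunctor_finset_sup.1 (ht.symm ▸ hy)
    exact ⟨⟨K, hS K hK⟩, hyK⟩
  obtain ⟨Φ, hΦ, hΦ'⟩ := hξ.exists_glue_clm hV hU φ zero_le_one (fun K => Banc.norm_clm_le _) (by
    intro K L y hK hL a
    have hy : y ∈ (stoneFunctor Ω).obj (K.1 ⊓ L.1) := mem_stoneFunctor_inf.2 ⟨hK, hL⟩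
    have h : res ξ (stoneFunctor_mono (inf_le_left : K.1 ⊓ L.1 ≤ K.1)) (φ K a) =
        res ξ (stoneFunctor_mono (inf_le_right : K.1 ⊓ L.1 ≤ L.1)) (φ L a) :=
      congrArg (fun f => Banc.clm f a) (hx (homOfLE (inf_le_left : K.1 ⊓ L.1 ≤ K.1))
        (homOfLE (inf_le_right : K.1 ⊓ L.1 ≤ L.1)) K.2.2 L.2.2 (Subsingleton.elim _ _))
    rw [← germ_res ξ (stoneFunctor_mono inf_le_left) hy, h, germ_res])
  refine ⟨Banc.ofCLM (B := ξ.obj (op ((stoneFunctor Ω).obj E))) Φ hΦ, ?_, ?_⟩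
  · intro K f hf
    exact Banc.hom_ext fun a => hΦ' ⟨K, leOfHom f, hf⟩ a
  · intro g hg
    refine Banc.hom_ext fun a => hξ.isLocallyNormed.res_ext hV hU fun K => ?_
    exact (congrArg (fun f => Banc.clm f a) (hg (homOfLE K.2.1) K.2.2)).trans (hΦ' K a).symm

/-- A bounded natural transformation has the norm of its components over the clopen sets when the
norms of the sections of its target are local, since the norm of `τ(s)` can be computed on a cover by clopen sets. -/
lemma norm_stonePullbackBdd {ξ ζ : (Opens (Stone Ω))ᵒᵖ ⥤ Banc.{u} 𝕜} (hζ : IsLocallyNormed ζ)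
    (τ : BddNat ξ ζ) : ‖stonePullbackBdd Ω 𝕜 ξ ζ τ‖ = ‖τ‖ := by
  refine le_antisymm
    (lp.norm_le_of_forall_le (norm_nonneg τ) fun E => BddNat.norm_apply_le τ _)
    (lp.norm_le_of_forall_le (norm_nonneg _) fun U => ?_)
  refine ContinuousLinearMap.opNorm_le_bound _ (norm_nonneg _) fun s => ?_
  refine hζ U.unop _ _ (by positivity) fun x hx => ?_
  obtain ⟨E, hxE, hE⟩ := exists_mem_stoneFunctor_le hx
  refine ⟨_, hE, hxE, ?_⟩
  have h : res ζ hE (τ.1 U s) = τ.1 (op ((stoneFunctor Ω).obj E)) (res ξ hE s) :=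
    τ.2 (homOfLE hE).op s
  refine (congrArg norm h).trans_le ((ContinuousLinearMap.le_of_opNorm_le _
    (BddNat.norm_apply_le (stonePullbackBdd Ω 𝕜 ξ ζ τ) (op E)) _).trans ?_)
  gcongr
  exact norm_res_le ξ hE s

/-- A bounded natural transformation over the clopen sets extends to all open sets, since a section
over an open set is the patching of its restrictions to the clopen subsets. -/
lemma exists_stonePullbackBdd_eq {ξ ζ : (Opens (Stone Ω))ᵒᵖ ⥤ Banc.{u} 𝕜} (hζ : IsBanachSheaf ζ)
    (σ : BddNat ((stonePullback Ω 𝕜).obj ξ) ((stonePullback Ω 𝕜).obj ζ)) :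
    ∃ τ : BddNat ξ ζ, stonePullbackBdd Ω 𝕜 ξ ζ τ = σ := by
  let ι : Opens (Stone Ω) → Type u := fun U => {E : Ω // (stoneFunctor Ω).obj E ≤ U}
  let σ' : ∀ E : Ω, ξ.obj (op ((stoneFunctor Ω).obj E)) →L[𝕜]
    ζ.obj (op ((stoneFunctor Ω).obj E)) := fun E => σ.1 (op E)
  have hσ' : ∀ {E F : Ω} (h : F ≤ E) (s : ξ.obj (op ((stoneFunctor Ω).obj E))),
      res ζ (stoneFunctor_mono h) (σ' E s) = σ' F (res ξ (stoneFunctor_mono h) s) :=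
    fun h s => σ.2 (homOfLE h).op s
  have hσn : ∀ E, ‖σ' E‖ ≤ ‖σ‖ := fun E => BddNat.norm_apply_le σ (op E)
  have hU : ∀ U : Opens (Stone Ω), ∀ x ∈ U, ∃ E : ι U, x ∈ (stoneFunctor Ω).obj E.1 := by
    intro U x hx
    obtain ⟨E, hxE, hE⟩ := exists_mem_stoneFunctor_le hx
    exact ⟨⟨E, hE⟩, hxE⟩
  choose T hT hT' using fun U : Opens (Stone Ω) =>
    hζ.exists_glue_clm (U := U) (V := fun E : ι U => (stoneFunctor Ω).obj E.1) (fun E => E.2)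
      (hU U) (fun E : ι U => (σ' E.1).comp (res ξ E.2)) (norm_nonneg σ) (by
        intro E
        refine ((σ' E.1).opNorm_comp_le _).trans ?_
        exact (mul_le_of_le_one_right (norm_nonneg _) (Banc.norm_clm_le _)).trans (hσn _)) (by
        intro E F x hE hF s
        have hx : x ∈ (stoneFunctor Ω).obj (E.1 ⊓ F.1) := mem_stoneFunctor_inf.2 ⟨hE, hF⟩
        rw [← germ_res ζ (stoneFunctor_mono (inf_le_left : E.1 ⊓ F.1 ≤ E.1)) hx,
          ← germ_res ζ (stoneFunctor_mono (inf_le_right : E.1 ⊓ F.1 ≤ F.1)) hx]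
        simp only [ContinuousLinearMap.comp_apply]
        rw [hσ' (inf_le_left : E.1 ⊓ F.1 ≤ E.1), hσ' (inf_le_right : E.1 ⊓ F.1 ≤ F.1), res_res,
          res_res])
  have hT'' : ∀ (U : Opens (Stone Ω)) (E : ι U) (s : ξ.obj (op U)),
      res ζ E.2 (T U s) = σ' E.1 (res ξ E.2 s) := hT'
  refine ⟨⟨⟨fun U => T U.unop, memℓp_infty ⟨‖σ‖, ?_⟩⟩, ?_⟩, ?_⟩
  · rintro _ ⟨U, rfl⟩
    exact hT U.unop
  · intro U W f s
    have hWU : W.unop ≤ U.unop := leOfHom f.unop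
    change res ζ hWU (T U.unop s) = T W.unop (res ξ hWU s)
    refine hζ.isLocallyNormed.res_ext (fun E : ι W.unop => E.2) (hU W.unop) fun E => ?_
    rw [hT'', res_res, hT'' U.unop ⟨E.1, E.2.trans hWU⟩, res_res]
  · refine Subtype.ext (lp.ext (funext fun E => ContinuousLinearMap.ext fun s => ?_))
    have h := hT'' ((stoneFunctor Ω).obj E.unop) ⟨E.unop, le_rfl⟩ s
    rw [res_self] at h
    exact h.trans (congrArg (σ' E.unop) (res_self ξ s))

end Pullback

/-! ### Sheaves for the finite topology -/

section FiniteTopology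

variable {𝕜 : Type*} [RCLike 𝕜] {Ω : Type u}

section Preorder

variable [Preorder Ω] (F : Ωᵒᵖ ⥤ Banc.{u} 𝕜)

/-- The restriction map `F(E) → F(G)` of a presheaf on a preorder, for `G ≤ E`. -/
def restr {E G : Ω} (h : G ≤ E) : F.obj (op E) →L[𝕜] F.obj (op G) :=
  Banc.clm (F.map (homOfLE h).op)

lemma norm_restr_le {E G : Ω} (h : G ≤ E) (a : F.obj (op E)) : ‖restr F h a‖ ≤ ‖a‖ :=
  Banc.norm_clm_apply_le _ a

@[simp]
lemma restr_self {E : Ω} (a : F.obj (op E)) : restr F le_rfl a = a := by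
  have h : (homOfLE (le_refl E)).op = 𝟙 (op E) := rfl
  rw [restr, h, F.map_id]
  rfl

@[simp]
lemma restr_restr {E G H : Ω} (h : G ≤ E) (h' : H ≤ G) (a : F.obj (op E)) :
    restr F h' (restr F h a) = restr F (h'.trans h) a := by
  have e : (homOfLE (h'.trans h)).op = (homOfLE h).op ≫ (homOfLE h').op := rfl
  rw [restr, restr, restr, e, F.map_comp]
  rfl

end Preorder

variable [BooleanAlgebra Ω] {F : Ωᵒᵖ ⥤ Banc.{u} 𝕜}

/-- The empty family covers `⊥`, so the identity and the zero map of `F(⊥)` agree. -/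
lemma eq_zero_of_isSheaf (hF : Presheaf.IsSheaf (finiteTopology Ω) F) (a : F.obj (op ⊥)) :
    a = 0 := by
  have hS : (⊥ : Sieve (⊥ : Ω)) ∈ finiteTopology Ω ⊥ := ⟨∅, by simp, by simp⟩
  have h := (hF (F.obj (op ⊥)) _ hS).isSeparatedFor.ext (t₁ := 𝟙 _)
    (t₂ := Banc.ofCLM 0 (by simp)) (fun _ _ hf => hf.elim)
  exact congrArg (fun f => Banc.clm f a) h

/-- The sieve on `E ⊔ G` generated by `E` and `G`. -/
def supSieve (E G : Ω) : Sieve (E ⊔ G) where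
  arrows K _ := K ≤ E ∨ K ≤ G
  downward_closed h g := h.imp (leOfHom g).trans (leOfHom g).trans

lemma supSieve_mem (E G : Ω) : supSieve E G ∈ finiteTopology Ω (E ⊔ G) := by
  classical
  refine ⟨{E, G}, by simp, ?_⟩
  intro K hK
  rcases Finset.mem_insert.1 hK with rfl | hK
  · exact ⟨le_sup_left, Or.inl le_rfl⟩
  · obtain rfl := Finset.mem_singleton.1 hK
    exact ⟨le_sup_right, Or.inr le_rfl⟩

/-- For disjoint `E` and `G`, any two morphisms into `F(E)` and `F(G)` patch to a morphism into
`F(E ⊔ G)`: on the members of the sieve generated by `E` and `G` they form a compatible family, as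
`F(⊥) = 0`. -/
lemma exists_glue_hom (hF : Presheaf.IsSheaf (finiteTopology Ω) F) {E G : Ω} (hEG : Disjoint E G)
    {A : Banc.{u} 𝕜} (α : A ⟶ F.obj (op E)) (β : A ⟶ F.obj (op G)) :
    ∃ γ : A ⟶ F.obj (op (E ⊔ G)), ∀ a,
      restr F le_sup_left (Banc.clm γ a) = Banc.clm α a ∧
      restr F le_sup_right (Banc.clm γ a) = Banc.clm β a := by
  classical
  let x : Presieve.FamilyOfElements (F ⋙ coyoneda.obj (op A)) (supSieve E G).arrows :=
    fun K f hf => if h : K ≤ E then α ≫ F.map (homOfLE h).op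
      else β ≫ F.map (homOfLE (hf.resolve_left h)).op
  -- Below both `E` and `G` there is only `⊥`, where all sections agree.
  have key : ∀ {L : Ω}, L ≤ E → L ≤ G → ∀ b c : F.obj (op L), b = c := by
    intro L hE hG b c
    obtain rfl : L = ⊥ := le_bot_iff.1 (hEG hE hG)
    rw [eq_zero_of_isSheaf hF b, eq_zero_of_isSheaf hF c]
  have hα : ∀ {K L : Ω} (f : K ⟶ E ⊔ G) (hf : supSieve E G f) (hL : L ≤ K) (h : L ≤ E) (a : A),
      restr F hL (Banc.clm (x f hf) a) = restr F h (Banc.clm α a) := by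
    intro K L f hf hL h a
    by_cases hK : K ≤ E
    · have hx : x f hf = α ≫ F.map (homOfLE hK).op := dif_pos hK
      rw [hx]
      exact restr_restr F hK hL _
    · exact key h (hL.trans (hf.resolve_left hK)) _ _
  have hβ : ∀ {K L : Ω} (f : K ⟶ E ⊔ G) (hf : supSieve E G f) (hL : L ≤ K) (h : L ≤ G) (a : A),
      restr F hL (Banc.clm (x f hf) a) = restr F h (Banc.clm β a) := by
    intro K L f hf hL h a
    by_cases hK : K ≤ E
    · exact key (hL.trans hK) h _ _
    · have hx : x f hf = β ≫ F.map (homOfLE (hf.resolve_left hK)).op := dif_neg hK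
      rw [hx]
      exact restr_restr F _ hL _
  have hx : x.Compatible := by
    intro K K' L g g' f f' hf hf' _
    refine Banc.hom_ext fun a => ?_
    change restr F (leOfHom g) (Banc.clm (x f hf) a) = restr F (leOfHom g') (Banc.clm (x f' hf') a)
    have hK : K ≤ E ∨ K ≤ G := hf
    rcases hK with h | h
    · have hL := (leOfHom g).trans h
      rw [hα f hf _ hL, hα f' hf' _ hL]
    · have hL := (leOfHom g).trans h
      rw [hβ f hf _ hL, hβ f' hf' _ hL]
  obtain ⟨γ, hγ, -⟩ := hF A _ (supSieve_mem E G) x hx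
  refine ⟨γ, fun a => ⟨?_, ?_⟩⟩
  · have h := hα (homOfLE le_sup_left) (Or.inl le_rfl) le_rfl le_rfl a
    rw [restr_self, restr_self] at h
    exact (congrArg (fun f => Banc.clm f a) (hγ (homOfLE le_sup_left) (Or.inl le_rfl))).trans h
  · have h := hβ (homOfLE le_sup_right) (Or.inr le_rfl) le_rfl le_rfl a
    rw [restr_self, restr_self] at h
    exact (congrArg (fun f => Banc.clm f a) (hγ (homOfLE le_sup_right) (Or.inr le_rfl))).trans h

/-- For disjoint `E` and `G`, a sheaf identifies `F(E ⊔ G)` with the product `F(E) × F(G)`. The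
test object is that product itself, which avoids a universe constraint on the scalars. -/
lemma exists_prod_section (hF : Presheaf.IsSheaf (finiteTopology Ω) F) {E G : Ω}
    (hEG : Disjoint E G) :
    ∃ γ : (F.obj (op E) × F.obj (op G)) → F.obj (op (E ⊔ G)), (∀ p, ‖γ p‖ ≤ ‖p‖) ∧
      (∀ p, restr F le_sup_left (γ p) = p.1 ∧ restr F le_sup_right (γ p) = p.2) ∧
      ∀ s, γ (restr F le_sup_left s, restr F le_sup_right s) = s := by
  let A : Banc.{u} 𝕜 := ⟨F.obj (op E) × F.obj (op G)⟩
  obtain ⟨γ, hγ⟩ := exists_glue_hom hF hEG (A := A)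
    (Banc.ofCLM (ContinuousLinearMap.fst 𝕜 _ _) (ContinuousLinearMap.norm_fst_le _ _ _))
    (Banc.ofCLM (ContinuousLinearMap.snd 𝕜 _ _) (ContinuousLinearMap.norm_snd_le _ _ _))
  refine ⟨fun p => Banc.clm γ p, fun p => Banc.norm_clm_apply_le γ p, hγ, fun s => ?_⟩
  let ρ : F.obj (op (E ⊔ G)) →L[𝕜] A := (restr F le_sup_left).prod (restr F le_sup_right)
  have hρ : ‖ρ‖ ≤ 1 := ContinuousLinearMap.opNorm_le_bound _ zero_le_one fun b => by
    rw [one_mul]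
    exact max_le (norm_restr_le F _ b) (norm_restr_le F _ b)
  -- Restricting to `E` and `G` and patching again agrees with the identity on the sieve.
  have h := (hF _ _ (supSieve_mem E G)).isSeparatedFor.ext (t₁ := Banc.ofCLM ρ hρ ≫ γ)
    (t₂ := 𝟙 (F.obj (op (E ⊔ G)))) (by
      intro K f hf
      refine Banc.hom_ext fun b => ?_
      change restr F (leOfHom f) (Banc.clm γ (ρ b)) = restr F (leOfHom f) b
      rcases hf with hK | hK
      · rw [← restr_restr F le_sup_left hK, (hγ (ρ b)).1, ← restr_restr F le_sup_left hK]
        rfl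
      · rw [← restr_restr F le_sup_right hK, (hγ (ρ b)).2, ← restr_restr F le_sup_right hK]
        rfl)
  exact congrArg (fun f => Banc.clm f s) h

lemma exists_glue_of_disjoint (hF : Presheaf.IsSheaf (finiteTopology Ω) F) {E G : Ω}
    (hEG : Disjoint E G) (a : F.obj (op E)) (b : F.obj (op G)) :
    ∃ c : F.obj (op (E ⊔ G)), restr F le_sup_left c = a ∧ restr F le_sup_right c = b := by
  obtain ⟨γ, -, hγ, -⟩ := exists_prod_section hF hEG
  exact ⟨γ (a, b), hγ (a, b)⟩

lemma norm_le_of_disjoint (hF : Presheaf.IsSheaf (finiteTopology Ω) F) {E G : Ω}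
    (hEG : Disjoint E G) (c : F.obj (op (E ⊔ G))) {r : ℝ} (hE : ‖restr F le_sup_left c‖ ≤ r)
    (hG : ‖restr F le_sup_right c‖ ≤ r) : ‖c‖ ≤ r := by
  obtain ⟨γ, hγ, -, hγ'⟩ := exists_prod_section hF hEG
  rw [← hγ' c]
  exact (hγ _).trans (max_le hE hG)

end FiniteTopology

/-! ### Extending a sheaf on the Boolean algebra to the open sets of the Stone space -/

section Extend

variable {𝕜 : Type*} [RCLike 𝕜] {Ω : Type u} [BooleanAlgebra Ω]

lemma stoneFunctor_le_iff {E F : Ω} :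
    (stoneFunctor Ω).obj E ≤ (stoneFunctor Ω).obj F ↔ E ≤ F :=
  (stoneIso Ω).le_iff_le

/-- Compactness of the clopen sets `η(E)`, as an induction principle: a property of elements of a
Boolean algebra which is inherited by smaller elements and by disjoint suprema, and which holds
locally on `η(E)`, holds for `E`. -/
lemma clopen_induction {Q : Ω → Prop} (bot : Q ⊥) (mono : ∀ {E G : Ω}, G ≤ E → Q E → Q G)
    (sup : ∀ {E G : Ω}, Disjoint E G → Q E → Q G → Q (E ⊔ G)) {E : Ω}
    (loc : ∀ x ∈ (stoneFunctor Ω).obj E, ∃ G, x ∈ (stoneFunctor Ω).obj G ∧ Q G) : Q E := by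
  obtain ⟨t, ht⟩ := (Stone.isClopen_setOf E).isClosed.isCompact.elim_finite_subcover
    (fun G : {G : Ω // Q G} => {x : Stone Ω | x.hom G = true})
    (fun G => Stone.isOpen_setOf G.1) (by
      intro x hx
      obtain ⟨G, hxG, hG⟩ := loc x hx
      exact Set.mem_iUnion.2 ⟨⟨G, hG⟩, hxG⟩)
  refine mono (E := t.sup Subtype.val) (stoneFunctor_le_iff.1 fun x hx => ?_)
    (Finset.sup_induction bot (fun a ha b hb => ?_) fun G _ => G.2)
  · obtain ⟨G, hGt, hG⟩ := Set.mem_iUnion₂.1 (ht hx)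
    exact stoneFunctor_mono (Finset.le_sup (f := Subtype.val) hGt) hG
  -- Arbitrary suprema reduce to disjoint ones, as `a ⊔ b = a ⊔ b \ a`.
  · rw [← sup_sdiff_self_right]
    exact sup disjoint_sdiff_self_right ha (mono sdiff_le hb)

variable (F : Ωᵒᵖ ⥤ Banc.{u} 𝕜)

/-- The bounded families `(s_E)`, `s_E ∈ F(E)`, indexed by the `E` with `η(E) ⊆ U`, which are
compatible with restriction. -/
def extendSubmodule (U : Opens (Stone Ω)) :
    Submodule 𝕜 (lp (fun E : {E : Ω // (stoneFunctor Ω).obj E ≤ U} => F.obj (op E.1)) ∞) where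
  carrier := {s | ∀ (E G : {E : Ω // (stoneFunctor Ω).obj E ≤ U}) (h : G.1 ≤ E.1),
    restr F h (s E) = s G}
  zero_mem' := by intro E G h; simp
  add_mem' := by intro s t hs ht E G h; simp [hs E G h, ht E G h]
  smul_mem' := by intro k s hs E G h; simp [hs E G h]

lemma isClosed_extendSubmodule (U : Opens (Stone Ω)) :
    IsClosed (extendSubmodule F U : Set (lp (fun E : {E : Ω // (stoneFunctor Ω).obj E ≤ U} =>
      F.obj (op E.1)) ∞)) := by
  have h : (extendSubmodule F U : Set (lp (fun E : {E : Ω // (stoneFunctor Ω).obj E ≤ U} =>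
      F.obj (op E.1)) ∞)) = ⋂ (E) (G) (h : G.1 ≤ E.1), {s | restr F h (s E) = s G} := by
    ext s
    simp only [Set.mem_iInter]
    rfl
  rw [h]
  exact isClosed_iInter fun E => isClosed_iInter fun G => isClosed_iInter fun h =>
    isClosed_eq ((restr F h).continuous.comp (lp.lipschitzWith_one_eval ∞ E).continuous)
      (lp.lipschitzWith_one_eval ∞ G).continuous

/-- The Banach space of bounded compatible families over the clopen subsets of `U`. -/
def extendObj (U : Opens (Stone Ω)) : Banc.{u} 𝕜 :=
  haveI : CompleteSpace (extendSubmodule F U) :=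
    (isClosed_extendSubmodule F U).completeSpace_coe
  ⟨extendSubmodule F U⟩

/-- Restriction of families to a smaller open set, as a linear map. -/
def extendResₗ {U V : Opens (Stone Ω)} (h : V ≤ U) :
    extendSubmodule F U →ₗ[𝕜] extendSubmodule F V where
  toFun s := ⟨⟨fun E => s.1 ⟨E.1, E.2.trans h⟩, memℓp_infty ⟨‖s.1‖, by
      rintro _ ⟨E, rfl⟩
      exact lp.norm_apply_le_norm ENNReal.top_ne_zero s.1 _⟩⟩,
    fun E G k => s.2 ⟨E.1, E.2.trans h⟩ ⟨G.1, G.2.trans h⟩ k⟩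
  map_add' _ _ := rfl
  map_smul' _ _ := rfl

lemma norm_extendResₗ_le {U V : Opens (Stone Ω)} (h : V ≤ U) (s : extendSubmodule F U) :
    ‖extendResₗ F h s‖ ≤ 1 * ‖s‖ := by
  rw [one_mul]
  exact lp.norm_le_of_forall_le (f := (extendResₗ F h s).1) (norm_nonneg s.1) fun E =>
    lp.norm_apply_le_norm ENNReal.top_ne_zero s.1 _

/-- Restriction of families to a smaller open set. -/
def extendRes {U V : Opens (Stone Ω)} (h : V ≤ U) :
    extendSubmodule F U →L[𝕜] extendSubmodule F V :=
  (extendResₗ F h).mkContinuous 1 (norm_extendResₗ_le F h)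

/-- The extension of a presheaf `F` on a Boolean algebra to a presheaf on its Stone space: the
sections over `U` are the elements of the limit, in `Banc 𝕜`, of the `F(E)` with `η(E) ⊆ U`. -/
def extend : (Opens (Stone Ω))ᵒᵖ ⥤ Banc.{u} 𝕜 where
  obj U := extendObj F U.unop
  map f := Banc.ofCLM (extendRes F (leOfHom f.unop))
    (LinearMap.mkContinuous_norm_le _ zero_le_one _)
  map_id _ := rfl
  map_comp _ _ := rfl

variable {F} in
/-- The section given by a bounded compatible family. -/
def extend.mk {U : Opens (Stone Ω)} (a : ∀ E : Ω, (stoneFunctor Ω).obj E ≤ U → F.obj (op E))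
    (M : ℝ) (hM : ∀ E h, ‖a E h‖ ≤ M)
    (ha : ∀ E G hE hG (h : G ≤ E), restr F h (a E hE) = a G hG) : (extend F).obj (op U) :=
  ⟨⟨fun E => a E.1 E.2, memℓp_infty ⟨M, by rintro _ ⟨E, rfl⟩; exact hM E.1 E.2⟩⟩,
    fun E G h => ha E.1 G.1 E.2 G.2 h⟩

/-- The value at `E`, for `η(E) ⊆ U`, of a section over `U` of the extension of `F`. -/
def extendEval {U : Opens (Stone Ω)} {E : Ω} (h : (stoneFunctor Ω).obj E ≤ U) :
    (extend F).obj (op U) →L[𝕜] F.obj (op E) :=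
  LinearMap.mkContinuous
    { toFun := fun s : extendSubmodule F U => s.1 ⟨E, h⟩
      map_add' := fun _ _ => rfl
      map_smul' := fun _ _ => rfl } 1 fun s => by
    rw [one_mul]
    exact lp.norm_apply_le_norm ENNReal.top_ne_zero s.1 ⟨E, h⟩

variable {F} in
@[simp]
lemma extendEval_mk {U : Opens (Stone Ω)}
    (a : ∀ E : Ω, (stoneFunctor Ω).obj E ≤ U → F.obj (op E))
    (M : ℝ) (hM : ∀ E h, ‖a E h‖ ≤ M)
    (ha : ∀ E G hE hG (h : G ≤ E), restr F h (a E hE) = a G hG) {E : Ω}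
    (h : (stoneFunctor Ω).obj E ≤ U) : extendEval F h (extend.mk a M hM ha) = a E h := rfl

variable {F}

lemma norm_extendEval_le {U : Opens (Stone Ω)} {E : Ω} (h : (stoneFunctor Ω).obj E ≤ U)
    (s : (extend F).obj (op U)) : ‖extendEval F h s‖ ≤ ‖s‖ :=
  lp.norm_apply_le_norm ENNReal.top_ne_zero (Subtype.val (p := (· ∈ extendSubmodule F U)) s) ⟨E, h⟩

lemma norm_le_of_norm_extendEval_le {U : Opens (Stone Ω)} {s : (extend F).obj (op U)} {r : ℝ}
    (hr : 0 ≤ r) (h : ∀ (E : Ω) (hE : (stoneFunctor Ω).obj E ≤ U), ‖extendEval F hE s‖ ≤ r) : ‖s‖ ≤ r :=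
  lp.norm_le_of_forall_le (f := Subtype.val (p := (· ∈ extendSubmodule F U)) s) hr
    fun E => h E.1 E.2

lemma extendEval_ext {U : Opens (Stone Ω)} {s t : (extend F).obj (op U)}
    (h : ∀ (E : Ω) (hE : (stoneFunctor Ω).obj E ≤ U), extendEval F hE s = extendEval F hE t) :
    s = t :=
  Subtype.ext (lp.ext (funext fun E => h E.1 E.2))

lemma restr_extendEval {U : Opens (Stone Ω)} {E G : Ω} (hE : (stoneFunctor Ω).obj E ≤ U)
    (h : G ≤ E) (s : (extend F).obj (op U)) :
    restr F h (extendEval F hE s) = extendEval F ((stoneFunctor_mono h).trans hE) s :=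
  Subtype.property (p := (· ∈ extendSubmodule F U)) s ⟨E, hE⟩
    ⟨G, (stoneFunctor_mono h).trans hE⟩ h

@[simp]
lemma extendEval_res {U V : Opens (Stone Ω)} (h : V ≤ U) {E : Ω} (hE : (stoneFunctor Ω).obj E ≤ V)
    (s : (extend F).obj (op U)) :
    extendEval F hE (res (extend F) h s) = extendEval F (hE.trans h) s := rfl

variable (F) in
/-- The section over `η(E)` of the extension of `F` given by the restrictions of an element of
`F(E)`. -/
def extendSection (E : Ω) : F.obj (op E) →L[𝕜] (extend F).obj (op ((stoneFunctor Ω).obj E)) :=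
  LinearMap.mkContinuous
    { toFun := fun a => extend.mk (fun G hG => restr F (stoneFunctor_le_iff.1 hG) a) ‖a‖
        (fun G hG => norm_restr_le F _ a) (fun G H hG hH h => restr_restr F _ h a)
      map_add' := fun a b => extendEval_ext fun G hG => by simp
      map_smul' := fun k a => extendEval_ext fun G hG => by simp } 1 fun a => by
    rw [one_mul]
    exact norm_le_of_norm_extendEval_le (norm_nonneg a) fun G hG => norm_restr_le F _ a

@[simp]
lemma extendEval_extendSection {E G : Ω} (h : (stoneFunctor Ω).obj G ≤ (stoneFunctor Ω).obj E)
    (a : F.obj (op E)) :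
    extendEval F h (extendSection F E a) = restr F (stoneFunctor_le_iff.1 h) a := rfl

lemma norm_le_norm_extendSection {E : Ω} (a : F.obj (op E)) : ‖a‖ ≤ ‖extendSection F E a‖ := by
  have h := norm_extendEval_le le_rfl (extendSection F E a)
  rwa [extendEval_extendSection, restr_self] at h

lemma res_extendSection {E G : Ω} (h : G ≤ E) (a : F.obj (op E)) :
    res (extend F) (stoneFunctor_mono h) (extendSection F E a) =
      extendSection F G (restr F h a) :=
  extendEval_ext fun _ hH => (restr_restr F h (stoneFunctor_le_iff.1 hH) a).symm

/-- A section over `U` restricts on `η(E)` to the section given by its value at `E`. -/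
lemma res_eq_extendSection {U : Opens (Stone Ω)} {E : Ω} (h : (stoneFunctor Ω).obj E ≤ U)
    (s : (extend F).obj (op U)) :
    res (extend F) h s = extendSection F E (extendEval F h s) :=
  extendEval_ext fun _ hG => (restr_extendEval h (stoneFunctor_le_iff.1 hG) s).symm

lemma isLocallyNormed_extend (hF : Presheaf.IsSheaf (finiteTopology Ω) F) :
    IsLocallyNormed (extend F) := by
  intro U s r hr hloc
  refine norm_le_of_norm_extendEval_le hr fun E hE => ?_
  -- The inclusion `η(E) ⊆ U` is part of the property to which the induction applies, because `s`
  -- has a value at `E` only if it holds.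
  have key : ∃ h : (stoneFunctor Ω).obj E ≤ U, ‖extendEval F h s‖ ≤ r := by
    refine clopen_induction (Q := fun E => ∃ h : (stoneFunctor Ω).obj E ≤ U,
      ‖extendEval F h s‖ ≤ r) ?_ ?_ ?_ ?_
    · refine ⟨fun x hx => (notMem_stoneFunctor_bot hx).elim, ?_⟩
      rwa [eq_zero_of_isSheaf hF (extendEval F _ s), norm_zero]
    · rintro E G h ⟨hE, hr⟩
      refine ⟨(stoneFunctor_mono h).trans hE, ?_⟩
      rw [← restr_extendEval hE h]
      exact (norm_restr_le F h _).trans hr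
    · rintro E G hEG ⟨hE, hEr⟩ ⟨hG, hGr⟩
      have h : (stoneFunctor Ω).obj (E ⊔ G) ≤ U := fun x hx =>
        (mem_stoneFunctor_sup.1 hx).elim (fun k => hE k) (fun k => hG k)
      refine ⟨h, norm_le_of_disjoint hF hEG _ ?_ ?_⟩
      · rwa [restr_extendEval h]
      · rwa [restr_extendEval h]
    · intro x hx
      obtain ⟨W, hW, hxW, hWr⟩ := hloc x (hE hx)
      obtain ⟨G, hxG, hG⟩ := exists_mem_stoneFunctor_le hxW
      refine ⟨G, hxG, hG.trans hW, ?_⟩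
      rw [← extendEval_res hW hG]
      exact (norm_extendEval_le hG _).trans hWr
  exact key.2

/-- On a clopen set, a family of germs which is locally approximated by sections up to `ε` is
globally so: local approximations over disjoint clopen sets patch together. -/
lemma exists_norm_germ_sub_le (hF : Presheaf.IsSheaf (finiteTopology Ω) F) {U : Opens (Stone Ω)}
    (t : Etal (extend F) U) {ε : ℝ}
    (ht : ∀ x ∈ U, ∃ (V : Opens (Stone Ω)) (h : V ≤ U) (s : (extend F).obj (op V)),
      x ∈ V ∧ ‖Etal.res (extend F) h t - toEtal (extend F) V s‖ < ε)
    {E : Ω} (hE : (stoneFunctor Ω).obj E ≤ U) :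
    ∃ a : F.obj (op E), ∀ (x : Stone Ω) (hx : x ∈ (stoneFunctor Ω).obj E),
      ‖germ (extend F) hx (extendSection F E a) - t ⟨x, hE hx⟩‖ ≤ ε := by
  have key : ∃ (h : (stoneFunctor Ω).obj E ≤ U) (a : F.obj (op E)),
      ∀ (x : Stone Ω) (hx : x ∈ (stoneFunctor Ω).obj E),
        ‖germ (extend F) hx (extendSection F E a) - t ⟨x, h hx⟩‖ ≤ ε := by
    refine clopen_induction (Q := fun E => ∃ (h : (stoneFunctor Ω).obj E ≤ U) (a : F.obj (op E)),
      ∀ (x : Stone Ω) (hx : x ∈ (stoneFunctor Ω).obj E),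
        ‖germ (extend F) hx (extendSection F E a) - t ⟨x, h hx⟩‖ ≤ ε) ?_ ?_ ?_ ?_
    · exact ⟨fun x hx => (notMem_stoneFunctor_bot hx).elim, 0,
        fun x hx => (notMem_stoneFunctor_bot hx).elim⟩
    · rintro E G h ⟨hE, a, ha⟩
      refine ⟨(stoneFunctor_mono h).trans hE, restr F h a, fun x hx => ?_⟩
      rw [← res_extendSection h, germ_res]
      exact ha x _
    · rintro E G hEG ⟨hE, a, ha⟩ ⟨hG, b, hb⟩
      have h : (stoneFunctor Ω).obj (E ⊔ G) ≤ U := fun x hx =>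
        (mem_stoneFunctor_sup.1 hx).elim (fun k => hE k) (fun k => hG k)
      obtain ⟨c, rfl, rfl⟩ := exists_glue_of_disjoint hF hEG a b
      refine ⟨h, c, fun x hx => ?_⟩
      rcases mem_stoneFunctor_sup.1 hx with k | k
      · have hx := ha x k
        rwa [← res_extendSection, germ_res] at hx
      · have hx := hb x k
        rwa [← res_extendSection, germ_res] at hx
    · intro x hx
      obtain ⟨V, hV, s, hxV, hs⟩ := ht x (hE hx)
      obtain ⟨G, hxG, hG⟩ := exists_mem_stoneFunctor_le hxV
      refine ⟨G, hxG, hG.trans hV, extendEval F hG s, fun y hy => ?_⟩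
      rw [← res_eq_extendSection hG, germ_res, norm_sub_rev]
      exact (lp.norm_apply_le_norm ENNReal.top_ne_zero
        (Etal.res (extend F) hV t - toEtal (extend F) V s) ⟨y, hG hy⟩).trans hs.le
  exact key.2

/-- On a clopen set, a family of germs which is locally approximated by sections with arbitrary
precision comes from a section: global approximations form a Cauchy sequence. -/
lemma exists_germ_eq (hF : Presheaf.IsSheaf (finiteTopology Ω) F) {U : Opens (Stone Ω)}
    (t : Etal (extend F) U)
    (ht : ∀ ε : ℝ, 0 < ε → ∀ x ∈ U, ∃ (V : Opens (Stone Ω)) (h : V ≤ U)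
      (s : (extend F).obj (op V)),
      x ∈ V ∧ ‖Etal.res (extend F) h t - toEtal (extend F) V s‖ < ε)
    {E : Ω} (hE : (stoneFunctor Ω).obj E ≤ U) :
    ∃ a : F.obj (op E), ∀ (x : Stone Ω) (hx : x ∈ (stoneFunctor Ω).obj E),
      germ (extend F) hx (extendSection F E a) = t ⟨x, hE hx⟩ := by
  have hε : ∀ n : ℕ, (0 : ℝ) < 1 / ((n : ℝ) + 1) := fun n => Nat.one_div_pos_of_nat
  choose a ha using fun n : ℕ => exists_norm_germ_sub_le hF t (ht _ (hε n)) hE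
  have hlim := tendsto_one_div_add_atTop_nhds_zero_nat (𝕜 := ℝ)
  have hcauchy : CauchySeq a := by
    refine cauchySeq_of_le_tendsto_0 (fun n : ℕ => 1 / ((n : ℝ) + 1) + 1 / ((n : ℝ) + 1)) ?_
      (by simpa using hlim.add hlim)
    intro n m N hn hm
    rw [dist_eq_norm]
    refine (norm_le_norm_extendSection _).trans ?_
    refine (isLocallyNormed_extend hF).norm_le_of_norm_germ_le (U := (stoneFunctor Ω).obj E) _
      (add_pos (hε N) (hε N)).le fun x hx => ?_
    rw [map_sub, germ_sub, ← sub_sub_sub_cancel_right _ _ (t ⟨x, hE hx⟩)]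
    refine (norm_sub_le _ _).trans (add_le_add ?_ ?_)
    · exact (ha n x hx).trans (Nat.one_div_le_one_div hn)
    · exact (ha m x hx).trans (Nat.one_div_le_one_div hm)
  obtain ⟨b, hb⟩ := cauchySeq_tendsto_of_complete hcauchy
  refine ⟨b, fun x hx => ?_⟩
  refine tendsto_nhds_unique (((continuous_germ (extend F) hx).comp
    (extendSection F E).continuous).tendsto b |>.comp hb) ?_
  exact tendsto_iff_norm_sub_tendsto_zero.2
    (squeeze_zero (fun _ => norm_nonneg _) (fun n => ha n x hx) hlim)

/-- The values on the clopen subsets of `U` of the sections provided by `exists_germ_eq` are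
compatible, since a section is determined by its germs, and hence form a section over `U`. -/
lemma isBanachSheaf_extend (hF : Presheaf.IsSheaf (finiteTopology Ω) F) :
    IsBanachSheaf (extend F) where
  uniqueness := (isLocallyNormed_extend hF).uniqueness
  approximation U t ht := by
    have hloc := isLocallyNormed_extend hF
    choose a ha using fun (E : Ω) (hE : (stoneFunctor Ω).obj E ≤ U) => exists_germ_eq hF t ht hE
    have hnorm : ∀ E hE, ‖a E hE‖ ≤ ‖t‖ := fun E hE =>
      (norm_le_norm_extendSection _).trans (hloc.norm_le_of_norm_germ_le
        (U := (stoneFunctor Ω).obj E) _ (norm_nonneg t) fun x hx => by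
          rw [ha E hE x hx]
          exact lp.norm_apply_le_norm ENNReal.top_ne_zero t _)
    have hcomp : ∀ E G hE hG (h : G ≤ E), restr F h (a E hE) = a G hG := by
      intro E G hE hG h
      rw [← sub_eq_zero, ← norm_le_zero_iff]
      refine (norm_le_norm_extendSection _).trans (hloc.norm_le_of_norm_germ_le
        (U := (stoneFunctor Ω).obj G) _ le_rfl fun x hx => ?_)
      rw [map_sub, germ_sub, ← res_extendSection, germ_res, ha, ha, sub_self, norm_zero]
    refine ⟨extend.mk a ‖t‖ hnorm hcomp, lp.ext (funext fun x => ?_)⟩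
    obtain ⟨E, hxE, hE⟩ := exists_mem_stoneFunctor_le x.2
    have h := ha E hE x.1 hxE
    rw [← extendEval_mk a ‖t‖ hnorm hcomp hE, ← res_eq_extendSection, germ_res] at h
    exact h.symm

variable (F) in
/-- Over the clopen sets, the extension of `F` is `F`. -/
def stonePullbackExtendIso : (stonePullback Ω 𝕜).obj (extend F) ≅ F :=
  NatIso.ofComponents (fun E =>
    { hom := Banc.ofCLM (extendEval F (U := (stoneFunctor Ω).obj E.unop) le_rfl)
        (LinearMap.mkContinuous_norm_le _ zero_le_one _)
      inv := Banc.ofCLM (extendSection F E.unop) (LinearMap.mkContinuous_norm_le _ zero_le_one _)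
      hom_inv_id := Banc.hom_ext fun s => by
        have h := res_eq_extendSection (F := F) (le_refl ((stoneFunctor Ω).obj E.unop)) s
        exact h.symm.trans (res_self (extend F) s)
      inv_hom_id := Banc.hom_ext fun a => restr_self F a })
    fun {E G} f => Banc.hom_ext fun s =>
      (restr_extendEval (F := F) (le_refl ((stoneFunctor Ω).obj E.unop)) (leOfHom f.unop) s).symm

end Extend

/-! ### The equivalence -/

section Equivalence

variable {𝕜 : Type*} [RCLike 𝕜] {Ω : Type u} [BooleanAlgebra Ω]

lemma bijective_stonePullbackBdd {ξ ζ : (Opens (Stone Ω))ᵒᵖ ⥤ Banc.{u} 𝕜} (hζ : IsBanachSheaf ζ) :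
    Function.Bijective (stonePullbackBdd Ω 𝕜 ξ ζ) :=
  ⟨(AddMonoidHomClass.isometry_of_norm _
    (norm_stonePullbackBdd hζ.isLocallyNormed)).injective, exists_stonePullbackBdd_eq hζ⟩

variable (h : ∀ ξ : (Opens (Stone Ω))ᵒᵖ ⥤ Banc.{u} 𝕜, IsBanachSheaf ξ →
  Presheaf.IsSheaf (finiteTopology Ω) ((stonePullback Ω 𝕜).obj ξ))

lemma faithful_stonePullbackShv : (stonePullbackShv Ω 𝕜 h).Faithful where
  map_injective {ξ ζ} f g hfg := by
    have hfg' : (stonePullback Ω 𝕜).map f.hom = (stonePullback Ω 𝕜).map g.hom :=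
      congrArg (fun k => k.hom) hfg
    have hb : BddNat.ofNatTrans f.hom = BddNat.ofNatTrans g.hom :=
      (bijective_stonePullbackBdd ζ.property).1
        (congrArg BddNat.ofNatTrans hfg')
    refine ObjectProperty.hom_ext _ (NatTrans.ext (funext fun U => Banc.hom_ext fun s => ?_))
    exact congrArg (fun τ : BddNat ξ.obj ζ.obj => τ.1 U s) hb

lemma full_stonePullbackShv : (stonePullbackShv Ω 𝕜 h).Full where
  map_surjective {ξ ζ} g := by
    obtain ⟨τ, hτ⟩ := (bijective_stonePullbackBdd (ξ := ξ.obj) ζ.property).2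
      (BddNat.ofNatTrans g.hom)
    have hn : ‖τ‖ ≤ 1 := by
      rw [← norm_stonePullbackBdd ζ.property.isLocallyNormed, hτ]
      exact BddNat.norm_ofNatTrans_le g.hom
    refine ⟨ObjectProperty.homMk (BddNat.toNatTrans τ hn), ?_⟩
    refine ObjectProperty.hom_ext _ (NatTrans.ext (funext fun E => Banc.hom_ext fun s => ?_))
    exact congrArg (fun τ : BddNat ((stonePullback Ω 𝕜).obj ξ.obj)
      ((stonePullback Ω 𝕜).obj ζ.obj) => τ.1 E s) hτ

lemma essSurj_stonePullbackShv : (stonePullbackShv Ω 𝕜 h).EssSurj where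
  mem_essImage F := ⟨⟨extend F.obj, isBanachSheaf_extend F.property⟩,
    ⟨ObjectProperty.isoMk _ (stonePullbackExtendIso F.obj)⟩⟩

end Equivalence

end BanachSheaf

end

theorem mainTheorem3 (𝕜 : Type*) [RCLike 𝕜] (Ω : Type u) [BooleanAlgebra Ω] :
    ∃ h : ∀ ξ : (Opens (BanachSheaf.Stone Ω))ᵒᵖ ⥤ BanachSheaf.Banc.{u} 𝕜,
        BanachSheaf.IsBanachSheaf ξ →
          Presheaf.IsSheaf (BanachSheaf.finiteTopology Ω)
            ((BanachSheaf.stonePullback Ω 𝕜).obj ξ),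
      (BanachSheaf.stonePullbackShv Ω 𝕜 h).IsEquivalence ∧
      ∀ ξ ζ : (Opens (BanachSheaf.Stone Ω))ᵒᵖ ⥤ BanachSheaf.Banc.{u} 𝕜,
        BanachSheaf.IsBanachSheaf ξ → BanachSheaf.IsBanachSheaf ζ →
          Function.Bijective (BanachSheaf.stonePullbackBdd Ω 𝕜 ξ ζ) ∧
          ∀ τ : BanachSheaf.BddNat ξ ζ, ‖BanachSheaf.stonePullbackBdd Ω 𝕜 ξ ζ τ‖ = ‖τ‖ := by
  have h : ∀ ξ : (Opens (BanachSheaf.Stone Ω))ᵒᵖ ⥤ BanachSheaf.Banc.{u} 𝕜,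
      BanachSheaf.IsBanachSheaf ξ → Presheaf.IsSheaf (BanachSheaf.finiteTopology Ω)
        ((BanachSheaf.stonePullback Ω 𝕜).obj ξ) := fun _ hξ =>
    BanachSheaf.isSheaf_stonePullback hξ
  exact ⟨h,
    { faithful := BanachSheaf.faithful_stonePullbackShv h
      full := BanachSheaf.full_stonePullbackShv h
      essSurj := BanachSheaf.essSurj_stonePullbackShv h },
    fun _ _ _ hζ => ⟨BanachSheaf.bijective_stonePullbackBdd hζ,
      BanachSheaf.norm_stonePullbackBdd hζ.isLocallyNormed⟩⟩
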